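/- Let $(\beta_n)_{n\ge1}$ be the sequence \[ 0,\ -\tfrac12,0,\tfrac12,\ -\tfrac34,-\tfrac12,-\tfrac14,0,\tfrac14,\tfrac12,\tfrac34,\ -\tfrac78,\dots \] which, for $m=0,1,2,\dots$ successively, lists $j/2^m$ for all integers $j$ with $-2^m<j<2^m$ in increasing order (not necessarily in lowest terms). Let $a_{2n-1}=3$ and $a_{2n}=1$ for $n\ge1$, let $b_1=\beta_1$, and let $b_k=\beta_n$ whenever $n\ge1$ and $2n^2\le k<2(n+1)^2$. Then the Jacobi matrix $L$ with diagonal entries $b_1,b_2,\dots$ and off-diagonal entries $a_1,a_2,\dots$ defines a bounded self-adjoint operator on $\ell^2(\{1,2,3,\dots\})$. Let $\mu$ be its spectral measure at the first basis vector $\delta_1$, i.e. the measure on $\mathbb{R}$ with $\int f\,d\mu=\langle\delta_1,f(L)\delta_1\rangle$ for all continuous $f:\mathbb{R}\to\mathbb{R}$. The orthonormal polynomials $p_n$ of $\mu$ ($\deg p_n=n$, positive leading coefficient, $\int p_np_m\,d\mu=\delta_{nm}$) exist and have $a_n,b_n$ as recursion coefficients, \[ x\,p_n(x)=a_{n+1}p_{n+1}(x)+b_{n+1}p_n(x)+a_np_{n-1}(x)\quad(n\ge0,\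 p_{-1}=0), \] and the following hold. 1. $\operatorname{supp}\mu=[-5,-1]\cup[1,5]$. 2. For every $n\ge1$ there is a real $x_n$ with $|x_n-\beta_n|\le 2\cdot3^{-2n}$ and $p_{2(n+1)^2-1}(x_n)=0$. Moreover, the set $\{x\in(-1,1)\mid p_n(x)=0\text{ for some }n\}$ is dense in $[-1,1]$. -/

import Mathlib

open MeasureTheory Polynomial
open scoped ENNReal

namespace GapExample

/-- Enumeration of the pairs `(m, j)` with `m = 0, 1, 2, …` and, for each `m`, `j` running
increasingly through the integers with `-2 ^ m < j < 2 ^ m`. -/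
def dyadicIndex : ℕ → ℕ × ℤ
  | 0 => (0, 0)
  | n + 1 =>
    if (dyadicIndex n).2 + 1 < 2 ^ (dyadicIndex n).1 then
      ((dyadicIndex n).1, (dyadicIndex n).2 + 1)
    else
      ((dyadicIndex n).1 + 1, 1 - 2 ^ ((dyadicIndex n).1 + 1))

/-- The sequence `β₁, β₂, … = 0, -1/2, 0, 1/2, -3/4, -1/2, -1/4, 0, 1/4, 1/2, 3/4, -7/8, …`.
It is indexed from `1`; the value at `0` plays no role. -/
noncomputable def beta (n : ℕ) : ℝ :=
  ((dyadicIndex (n - 1)).2 : ℝ) / 2 ^ (dyadicIndex (n - 1)).1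

/-- Off-diagonal Jacobi parameters `a₁, a₂, … = 3, 1, 3, 1, …` (the value at `0` plays no role). -/
noncomputable def aSeq (n : ℕ) : ℝ := if Odd n then 3 else 1

/-- Diagonal Jacobi parameters: `b₁ = β₁`, and `b_k = β_n` when `2 n ^ 2 ≤ k < 2 (n + 1) ^ 2`,
`n ≥ 1` (the value at `0` plays no role). -/
noncomputable def bSeq (k : ℕ) : ℝ := if k ≤ 1 then beta 1 else beta (Nat.sqrt (k / 2))

theorem bSeq_one : bSeq 1 = beta 1 := by simp [bSeq]

theorem bSeq_block {n k : ℕ} (hn : 1 ≤ n) (h₁ : 2 * n ^ 2 ≤ k) (h₂ : k < 2 * (n + 1) ^ 2) :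
    bSeq k = beta n := by
  have h1 : 1 ≤ n ^ 2 := Nat.one_le_pow _ _ hn
  have hk : ¬ k ≤ 1 := by omega
  have hs : Nat.sqrt (k / 2) = n := by
    refine Nat.eq_sqrt'.2 ⟨?_, ?_⟩ |>.symm
    · omega
    · omega
  simp [bSeq, hk, hs]

/-- The Hilbert space `ℓ²` of square summable complex sequences; coordinate `k` here is the
coordinate number `k + 1` of the half-line `1, 2, 3, …`. -/
abbrev EllTwo : Type := lp (fun _ : ℕ => ℂ) 2

/-- The first basis vector of `ℓ²`. -/
noncomputable def firstVec : EllTwo := lp.single 2 0 (1 : ℂ)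

/-- The bounded operator `L` on `ℓ²` is given by the Jacobi matrix with diagonal `b₁, b₂, …` and
off-diagonal `a₁, a₂, …`. -/
def IsJacobiOperator (a b : ℕ → ℝ) (L : EllTwo →L[ℂ] EllTwo) : Prop :=
  ∀ u : EllTwo,
    L u 0 = (b 1 : ℂ) * u 0 + (a 1 : ℂ) * u 1 ∧
    ∀ k : ℕ, L u (k + 1) =
      (a (k + 1) : ℂ) * u k + (b (k + 2) : ℂ) * u (k + 1) + (a (k + 2) : ℂ) * u (k + 2)

/-- `μ` is the spectral measure of the bounded self-adjoint operator `T` at the vector `v`: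
`∫ f dμ = ⟨v, f(T) v⟩` for every continuous `f`. -/
def IsSpectralMeasure {H : Type*} [NormedAddCommGroup H] [InnerProductSpace ℂ H]
    [CompleteSpace H] (T : H →L[ℂ] H) (v : H) (μ : Measure ℝ) : Prop :=
  IsSelfAdjoint T ∧
    ∀ f : ℝ → ℝ, Continuous f →
      Integrable f μ ∧ ((∫ x, f x ∂μ : ℝ) : ℂ) = inner ℂ v (cfc f T v)

/-- `p₀, p₁, …` are the orthonormal polynomials of `μ`, with positive leading coefficients. -/
def IsOrthonormalPolynomials (μ : Measure ℝ) (p : ℕ → ℝ[X]) : Prop :=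
  (∀ n, (p n).natDegree = n ∧ 0 < (p n).leadingCoeff) ∧
    ∀ n m, Integrable (fun x => (p n).eval x * (p m).eval x) μ ∧
      ∫ x, (p n).eval x * (p m).eval x ∂μ = if n = m then 1 else 0

/-- `p` has the recursion coefficients `a₁, a₂, …`, `b₁, b₂, …`:
`x pₙ = a_{n+1} p_{n+1} + b_{n+1} pₙ + aₙ p_{n-1}` for `n ≥ 0`, where `p_{-1} = 0`. -/
def HasRecursion (a b : ℕ → ℝ) (p : ℕ → ℝ[X]) : Prop :=
  X * p 0 = C (a 1) * p 1 + C (b 1) * p 0 ∧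
    ∀ n : ℕ, X * p (n + 1) =
      C (a (n + 2)) * p (n + 2) + C (b (n + 2)) * p (n + 1) + C (a (n + 1)) * p n

end GapExample

namespace GapExample

/-! ### Weighted permutation operators on `ℓ²` -/

/-! The matrix is three times a self-inverse contraction (the strong bonds) plus weak bonds and a
diagonal, each of norm at most one. The norm is therefore at most 5, and `isUnit_jacobiOp_sub`
inverts `x - L` for `|x| < 1`. This confines the support to the two bands.

Conversely, inside block `n` the matrix is `β_n` plus the period-two matrix with bonds 3, 1, whose
plane waves have energies `τ ^ 2 = 10 + 6 cos θ`, that is `2 ≤ |τ| ≤ 4`. Cut off to the block, a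
wave has squared norm of order `n` and bounded error (`wave_bound`), so a neighbourhood of `β_n + τ`
cannot stay `μ`-null for large `n`. As the `β_n` return near every `y ∈ [-1, 1]`, all `y + τ` lie in
the support (`add_mem_support`), and these sums fill the bands.

The zeros of `p_N` are eigenvalues of the `N × N` corner. For `N = 2 (n + 1) ^ 2 - 1` the cut severs
a strong bond, which leaves an edge state at energy `β_n` decaying by `-1/3` per cell
(`jacobiAction_edgeState`). It is an eigenvector up to `3 ^ (-2 n)`, so an eigenvalue lies that
close to `β_n` although the gap contains no spectrum of `L`. -/

theorem summable_norm_sq (u : EllTwo) : Summable fun k => ‖u k‖ ^ 2 := by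
  simpa using (lp.memℓp u).summable (by simp)

theorem norm_sq_eq_tsum (u : EllTwo) : ‖u‖ ^ 2 = ∑' k, ‖u k‖ ^ 2 := by
  have := lp.norm_rpow_eq_tsum (p := 2) (by simp) u
  simpa using this

theorem memlp_weighted_comp (w : ℕ → ℝ) (σ : Equiv.Perm ℕ) (hw : ∀ k, |w k| ≤ 1) (u : EllTwo) :
    Memℓp (fun k => (w k : ℂ) * u (σ k)) 2 := by
  refine memℓp_gen ?_
  have h : Summable fun k => ‖u (σ k)‖ ^ 2 := (summable_norm_sq u).comp_injective σ.injective
  simp only [ENNReal.toReal_ofNat, Real.rpow_ofNat]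
  refine Summable.of_nonneg_of_le (fun k => by positivity) (fun k => ?_) h
  rw [norm_mul, mul_pow, Complex.norm_real, Real.norm_eq_abs]
  exact mul_le_of_le_one_left (by positivity) (pow_le_one₀ (abs_nonneg _) (hw k))

/-- The contraction `u ↦ (k ↦ w k * u (σ k))` of `ℓ²`, for weights bounded by `1`. -/
noncomputable def weightedPerm (w : ℕ → ℝ) (σ : Equiv.Perm ℕ) (hw : ∀ k, |w k| ≤ 1) :
    EllTwo →L[ℂ] EllTwo :=
  LinearMap.mkContinuous
    { toFun := fun u => ⟨fun k => (w k : ℂ) * u (σ k), memlp_weighted_comp w σ hw u⟩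
      map_add' := fun u v => by ext k; exact mul_add _ _ _
      map_smul' := fun c u => by ext k; exact mul_left_comm _ _ _ } 1 (by
    intro u
    rw [one_mul]
    refine le_of_sq_le_sq ?_ (norm_nonneg _)
    rw [norm_sq_eq_tsum, norm_sq_eq_tsum, ← σ.tsum_eq (fun k => ‖u k‖ ^ 2)]
    have h : Summable fun k => ‖u (σ k)‖ ^ 2 := (summable_norm_sq u).comp_injective σ.injective
    refine Summable.tsum_le_tsum (fun k => ?_) (summable_norm_sq _) h
    change ‖(w k : ℂ) * u (σ k)‖ ^ 2 ≤ _
    rw [norm_mul, mul_pow, Complex.norm_real, Real.norm_eq_abs]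
    exact mul_le_of_le_one_left (by positivity) (pow_le_one₀ (abs_nonneg _) (hw k)))

@[simp] theorem weightedPerm_apply (w : ℕ → ℝ) (σ : Equiv.Perm ℕ) (hw : ∀ k, |w k| ≤ 1)
    (u : EllTwo) (k : ℕ) : weightedPerm w σ hw u k = (w k : ℂ) * u (σ k) := rfl

theorem norm_weightedPerm_le (w : ℕ → ℝ) (σ : Equiv.Perm ℕ) (hw : ∀ k, |w k| ≤ 1) :
    ‖weightedPerm w σ hw‖ ≤ 1 :=
  LinearMap.mkContinuous_norm_le _ zero_le_one _

/-- Reindexing the inner product by the involution moves the real weighted permutation to the other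
factor. -/
theorem isSelfAdjoint_weightedPerm (w : ℕ → ℝ) (σ : Equiv.Perm ℕ) (hw : ∀ k, |w k| ≤ 1)
    (hσ : ∀ k, σ (σ k) = k) (hwσ : ∀ k, w (σ k) = w k) :
    IsSelfAdjoint (weightedPerm w σ hw) := by
  rw [ContinuousLinearMap.isSelfAdjoint_iff_isSymmetric]
  intro u v
  change inner ℂ (weightedPerm w σ hw u) v = inner ℂ u (weightedPerm w σ hw v)
  rw [lp.inner_eq_tsum, lp.inner_eq_tsum, ← σ.tsum_eq]
  refine tsum_congr fun k => ?_
  simp [hσ, hwσ, mul_assoc, mul_left_comm]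

/-! ### The Jacobi operator -/

/-- The involution of `ℕ` exchanging `2 j` and `2 j + 1`. -/
def swapEven : Equiv.Perm ℕ :=
  Function.Involutive.toPerm (fun k => if k % 2 = 0 then k + 1 else k - 1) (by
    intro k
    grind)

/-- The involution of `ℕ` fixing `0` and exchanging `2 j + 1` and `2 j + 2`. -/
def swapOdd : Equiv.Perm ℕ :=
  Function.Involutive.toPerm
    (fun k => if k = 0 then 0 else if k % 2 = 0 then k - 1 else k + 1) (by
    intro k
    grind)

theorem swapEven_apply (k : ℕ) : swapEven k = if k % 2 = 0 then k + 1 else k - 1 := rfl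

theorem swapOdd_apply (k : ℕ) :
    swapOdd k = if k = 0 then 0 else if k % 2 = 0 then k - 1 else k + 1 := rfl

theorem swapEven_swapEven (k : ℕ) : swapEven (swapEven k) = k :=
  swapEven.left_inv k

theorem swapOdd_swapOdd (k : ℕ) : swapOdd (swapOdd k) = k :=
  swapOdd.left_inv k

theorem dyadicIndex_bounds (n : ℕ) :
    -2 ^ (dyadicIndex n).1 < (dyadicIndex n).2 ∧ (dyadicIndex n).2 < 2 ^ (dyadicIndex n).1 := by
  induction n with
  | zero => simp [dyadicIndex]
  | succ n ih =>
    have h2 : (0 : ℤ) < 2 ^ ((dyadicIndex n).1 + 1) := by positivity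
    rw [dyadicIndex]
    split_ifs with h
    · exact ⟨by have := ih.1; dsimp only; omega, h⟩
    · refine ⟨?_, ?_⟩ <;> dsimp only <;> omega

theorem abs_beta_lt_one (n : ℕ) : |beta n| < 1 := by
  obtain ⟨h1, h2⟩ := dyadicIndex_bounds (n - 1)
  have hp : (0 : ℝ) < 2 ^ (dyadicIndex (n - 1)).1 := by positivity
  have h1' : -(2 : ℝ) ^ (dyadicIndex (n - 1)).1 < ((dyadicIndex (n - 1)).2 : ℝ) := by
    exact_mod_cast h1
  have h2' : ((dyadicIndex (n - 1)).2 : ℝ) < (2 : ℝ) ^ (dyadicIndex (n - 1)).1 := by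
    exact_mod_cast h2
  rw [beta, abs_lt, lt_div_iff₀ hp, div_lt_iff₀ hp]
  constructor <;> linarith

theorem abs_bSeq_le_one (k : ℕ) : |bSeq k| ≤ 1 := by
  rw [bSeq]; split_ifs <;> exact (abs_beta_lt_one _).le

instance : Nontrivial EllTwo :=
  ⟨firstVec, 0, fun h => by simpa [firstVec] using congrArg (fun u : EllTwo => u 0) h⟩

/-- The strong bonds `(1, 2), (3, 4), …` of the matrix. -/
noncomputable def strongBonds : EllTwo →L[ℂ] EllTwo :=
  weightedPerm (fun _ => 1) swapEven (by simp)

/-- The weak bonds `(2, 3), (4, 5), …` of the matrix. -/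
noncomputable def weakBonds : EllTwo →L[ℂ] EllTwo :=
  -- `swapOdd` fixes `0`; the zero weight there prevents a spurious diagonal entry.
  weightedPerm (fun k => if k = 0 then 0 else 1) swapOdd (by intro k; split_ifs <;> simp)

/-- The diagonal of the matrix. -/
noncomputable def diagonalPart : EllTwo →L[ℂ] EllTwo :=
  weightedPerm (fun k => bSeq (k + 1)) (Equiv.refl ℕ) (fun k => abs_bSeq_le_one (k + 1))

/-- The Jacobi operator with parameters `aSeq` and `bSeq`. -/
noncomputable def jacobiOp : EllTwo →L[ℂ] EllTwo :=
  (3 : ℂ) • strongBonds + weakBonds + diagonalPart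

theorem jacobiOp_apply (u : EllTwo) (k : ℕ) :
    jacobiOp u k = 3 * u (swapEven k) + (if k = 0 then 0 else 1) * u (swapOdd k) +
      bSeq (k + 1) * u k := by
  change (3 : ℂ) * (((1 : ℝ) : ℂ) * u (swapEven k)) +
    (((if k = 0 then 0 else 1 : ℝ) : ℝ) : ℂ) * u (swapOdd k) + (bSeq (k + 1) : ℂ) * u k = _
  split_ifs <;> simp

theorem jacobiOp_isJacobiOperator : IsJacobiOperator aSeq bSeq jacobiOp := by
  intro u
  constructor
  · simp [jacobiOp_apply, swapEven_apply, swapOdd_apply, aSeq]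
    ring
  · intro k
    rcases Nat.even_or_odd k with hk | hk
    · have h1 : (k + 1) % 2 ≠ 0 := by have := Nat.even_iff.1 hk; omega
      have h2 : ¬ Odd (k + 2) := by rw [Nat.odd_iff]; have := Nat.even_iff.1 hk; omega
      simp [jacobiOp_apply, swapEven_apply, swapOdd_apply, aSeq,
        h1, h2, hk.add_one]
      ring
    · have h1 : (k + 1) % 2 = 0 := by have := Nat.odd_iff.1 hk; omega
      have h2 : Odd (k + 2) := by rw [Nat.odd_iff]; have := Nat.odd_iff.1 hk; omega
      have h3 : ¬ Odd (k + 1) := by rw [Nat.odd_iff]; omega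
      simp [jacobiOp_apply, swapEven_apply, swapOdd_apply, aSeq,
        h1, h2, h3]
      ring

theorem isSelfAdjoint_jacobiOp : IsSelfAdjoint jacobiOp := by
  refine ((IsSelfAdjoint.smul (r := (3 : ℂ)) (Complex.conj_ofNat 3) ?_).add ?_).add ?_
  · exact isSelfAdjoint_weightedPerm _ _ _ swapEven_swapEven fun _ => rfl
  · refine isSelfAdjoint_weightedPerm _ _ _ swapOdd_swapOdd fun k => ?_
    have : swapOdd k = 0 ↔ k = 0 := by rw [swapOdd_apply]; grind
    simp [this]
  · exact isSelfAdjoint_weightedPerm _ _ _ (fun _ => rfl) fun _ => rfl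

theorem norm_jacobiOp_le : ‖jacobiOp‖ ≤ 5 := by
  have h1 : ‖strongBonds‖ ≤ 1 := norm_weightedPerm_le _ _ _
  have h2 : ‖weakBonds‖ ≤ 1 := norm_weightedPerm_le _ _ _
  have h3 : ‖diagonalPart‖ ≤ 1 := norm_weightedPerm_le _ _ _
  have h4 : ‖(3 : ℂ) • strongBonds‖ ≤ 3 := by
    rw [norm_smul]; norm_num; exact h1
  calc ‖jacobiOp‖ ≤ ‖(3 : ℂ) • strongBonds‖ + ‖weakBonds‖ + ‖diagonalPart‖ := norm_add₃_le
    _ ≤ 5 := by linarith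

theorem strongBonds_mul_self : strongBonds * strongBonds = 1 := by
  ext u k
  simp [strongBonds, swapEven_swapEven]

/-- The inverse of `3 • strongBonds` has norm at most `1/3`, while the remaining terms have norm at
most `1 + 1 + |x| < 3`, so the perturbed operator is still invertible. -/
theorem isUnit_jacobiOp_sub {x : ℝ} (hx : |x| < 1) :
    IsUnit (algebraMap ℝ (EllTwo →L[ℂ] EllTwo) x - jacobiOp) := by
  have h1 : ‖strongBonds‖ ≤ 1 := norm_weightedPerm_le _ _ _
  have h2 : ‖weakBonds‖ ≤ 1 := norm_weightedPerm_le _ _ _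
  have h3 : ‖diagonalPart‖ ≤ 1 := norm_weightedPerm_le _ _ _
  have h4 : ‖algebraMap ℝ (EllTwo →L[ℂ] EllTwo) x‖ ≤ |x| := by
    rw [Algebra.algebraMap_eq_smul_one]
    refine (norm_smul_le _ _).trans ?_
    rw [Real.norm_eq_abs]
    exact mul_le_of_le_one_right (abs_nonneg _) ContinuousLinearMap.norm_id_le
  have hP : strongBonds * strongBonds = 1 := strongBonds_mul_self
  let U : (EllTwo →L[ℂ] EllTwo)ˣ :=
    ⟨(3 : ℂ) • strongBonds, (3 : ℂ)⁻¹ • strongBonds, by simp [hP], by simp [hP]⟩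
  have hne : (0 : ℝ) < ‖((U⁻¹ : (EllTwo →L[ℂ] EllTwo)ˣ) : EllTwo →L[ℂ] EllTwo)‖ :=
    Units.norm_pos _
  have hU : ‖((U⁻¹ : (EllTwo →L[ℂ] EllTwo)ˣ) : EllTwo →L[ℂ] EllTwo)‖ ≤ 3⁻¹ := by
    change ‖(3 : ℂ)⁻¹ • strongBonds‖ ≤ 3⁻¹
    rw [norm_smul]; norm_num; linarith
  have ht : ‖weakBonds + diagonalPart - algebraMap ℝ (EllTwo →L[ℂ] EllTwo) x‖ <
      ‖((U⁻¹ : (EllTwo →L[ℂ] EllTwo)ˣ) : EllTwo →L[ℂ] EllTwo)‖⁻¹ := by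
    refine lt_of_lt_of_le (b := 3) ?_ (by rw [le_inv_comm₀ (by norm_num) hne]; exact hU)
    refine (norm_sub_le _ _).trans_lt ?_
    have := norm_add_le weakBonds diagonalPart
    linarith
  have h : IsUnit (-(algebraMap ℝ (EllTwo →L[ℂ] EllTwo) x - jacobiOp)) := by
    refine ⟨U.add _ ht, ?_⟩
    rw [Units.val_add]
    simp only [U, jacobiOp]
    abel
  simpa using h.neg

theorem spectrum_jacobiOp_subset :
    spectrum ℝ jacobiOp ⊆ Set.Icc (-5 : ℝ) (-1) ∪ Set.Icc (1 : ℝ) 5 := by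
  intro x hx
  have h1 : ¬ |x| < 1 := fun h => hx (isUnit_jacobiOp_sub h)
  have h5 : |x| ≤ 5 := (spectrum.norm_le_norm_of_mem hx).trans norm_jacobiOp_le
  rw [abs_le] at h5
  rw [abs_lt, not_and_or] at h1
  rcases h1 with h1 | h1
  · exact Or.inl ⟨h5.1, by linarith⟩
  · exact Or.inr ⟨by linarith, h5.2⟩

/-! ### Spectral measures -/

section SpectralMeasure

variable {H : Type*} [NormedAddCommGroup H] [InnerProductSpace ℂ H] [CompleteSpace H]

theorem ofReal_re_inner_apply_self {A : H →L[ℂ] H} (hA : IsSelfAdjoint A) (v : H) :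
    (((inner ℂ v (A v)).re : ℝ) : ℂ) = inner ℂ v (A v) := by
  refine Complex.conj_eq_iff_re.1 ?_
  rw [inner_conj_symm]
  exact (ContinuousLinearMap.isSelfAdjoint_iff_isSymmetric.1 hA) v v

theorem isSelfAdjoint_cfcHom {T : H →L[ℂ] H} (hT : IsSelfAdjoint T) (f : C(spectrum ℝ T, ℝ)) :
    IsSelfAdjoint (cfcHom (R := ℝ) hT f) :=
  cfcHom_predicate hT f

/-- With `g = √f` self-adjointness gives `⟪v, f(T) v⟫ = ‖g(T) v‖ ^ 2`. -/
theorem re_inner_cfcHom_nonneg {T : H →L[ℂ] H} (hT : IsSelfAdjoint T) (v : H)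
    {f : C(spectrum ℝ T, ℝ)} (hf : ∀ x, 0 ≤ f x) :
    0 ≤ (inner ℂ v (cfcHom (R := ℝ) hT f v)).re := by
  let g : C(spectrum ℝ T, ℝ) := ⟨fun x => Real.sqrt (f x), by fun_prop⟩
  have hg : f = g * g := by
    ext x
    exact (Real.mul_self_sqrt (hf x)).symm
  have hs := ContinuousLinearMap.isSelfAdjoint_iff_isSymmetric.1 (isSelfAdjoint_cfcHom hT g)
  rw [hg, map_mul]
  have h : inner ℂ v ((cfcHom (R := ℝ) hT g * cfcHom (R := ℝ) hT g) v) =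
      inner ℂ (cfcHom (R := ℝ) hT g v) (cfcHom (R := ℝ) hT g v) :=
    (hs v (cfcHom (R := ℝ) hT g v)).symm
  rw [h]
  exact inner_self_nonneg (𝕜 := ℂ)

/-- The positive functional `f ↦ ⟪v, f(T) v⟫` on the continuous functions on the spectrum. -/
noncomputable def spectralFunctional {T : H →L[ℂ] H} (hT : IsSelfAdjoint T) (v : H) :
    CompactlySupportedContinuousMap (spectrum ℝ T) ℝ →ₚ[ℝ] ℝ :=
  PositiveLinearMap.mk₀
    { toFun := fun f => (inner ℂ v (cfcHom (R := ℝ) hT f.toContinuousMap v)).re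
      map_add' := fun f g => by
        have h : (f + g).toContinuousMap = f.toContinuousMap + g.toContinuousMap := rfl
        rw [h, map_add, add_apply, inner_add_right, Complex.add_re]
      map_smul' := fun c f => by
        have h : (c • f).toContinuousMap = c • f.toContinuousMap := rfl
        rw [h, map_smul, smul_apply, inner_smul_right_eq_smul]
        simp }
    fun _ hf => re_inner_cfcHom_nonneg hT v hf

/-- Riesz–Markov–Kakutani on the compact spectrum, followed by push-forward to the line. -/
theorem exists_isSpectralMeasure {T : H →L[ℂ] H} (hT : IsSelfAdjoint T) (v : H) :
    ∃ μ : Measure ℝ, IsSpectralMeasure T v μ := by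
  have : CompactSpace (spectrum ℝ T) :=
    isCompact_iff_compactSpace.1 (ContinuousFunctionalCalculus.isCompact_spectrum T)
  refine ⟨(RealRMK.rieszMeasure (spectralFunctional hT v)).map Subtype.val, hT, fun f hf => ?_⟩
  have hfr : Continuous fun x : spectrum ℝ T => f x := by fun_prop
  constructor
  · refine (integrable_map_measure hf.aestronglyMeasurable (by fun_prop)).2 ?_
    exact hfr.integrable_of_hasCompactSupport (HasCompactSupport.of_compactSpace _)
  · rw [integral_map (by fun_prop) hf.aestronglyMeasurable]
    have h := RealRMK.integral_rieszMeasure (spectralFunctional hT v)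
      ⟨⟨fun x : spectrum ℝ T => f x, hfr⟩, HasCompactSupport.of_compactSpace _⟩
    rw [cfc_apply f T hT hf.continuousOn, ← ofReal_re_inner_apply_self (isSelfAdjoint_cfcHom hT _)]
    exact congrArg _ h

theorem IsSpectralMeasure.integral_eval_mul_eval {T : H →L[ℂ] H} {v : H} {μ : Measure ℝ}
    (h : IsSpectralMeasure T v μ) (q r : ℝ[X]) :
    ((∫ x, q.eval x * r.eval x ∂μ : ℝ) : ℂ) = inner ℂ (aeval T q v) (aeval T r v) := by
  have h1 := (h.2 (fun x => (q * r).eval x) (q * r).continuous).2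
  have hq : IsSelfAdjoint (aeval T q) := by
    rw [← cfc_polynomial q T h.1]
    exact cfc_predicate _ _
  rw [cfc_polynomial (q * r) T h.1, map_mul] at h1
  simp only [eval_mul] at h1
  rw [h1]
  exact ((ContinuousLinearMap.isSelfAdjoint_iff_isSymmetric.1 hq) v (aeval T r v)).symm

theorem IsSpectralMeasure.integrable_eval {T : H →L[ℂ] H} {v : H} {μ : Measure ℝ}
    (h : IsSpectralMeasure T v μ) (q : ℝ[X]) : Integrable (fun x => q.eval x) μ :=
  (h.2 _ q.continuous).1

/-- The distance to `S` vanishes on the spectrum, so its functional calculus is zero and its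
integral vanishes. Being nonnegative, it is zero almost everywhere. -/
theorem IsSpectralMeasure.support_subset {T : H →L[ℂ] H} {v : H} {μ : Measure ℝ}
    (h : IsSpectralMeasure T v μ) {S : Set ℝ} (hS : IsClosed S) (hne : S.Nonempty)
    (hTS : spectrum ℝ T ⊆ S) : μ.support ⊆ S := by
  refine Measure.support_subset_of_isClosed hS ?_
  have hc : Continuous fun x : ℝ => Metric.infDist x S := Metric.continuous_infDist_pt S
  obtain ⟨hi, he⟩ := h.2 _ hc
  have h0 : cfc (fun x : ℝ => Metric.infDist x S) T = 0 := by
    rw [cfc_congr (g := fun _ => (0 : ℝ)) fun x hx => Metric.infDist_zero_of_mem (hTS hx)]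
    exact cfc_const_zero ℝ T
  rw [h0] at he
  have he' : ∫ x, Metric.infDist x S ∂μ = 0 := by simpa using he
  rw [integral_eq_zero_iff_of_nonneg (fun x => Metric.infDist_nonneg) hi] at he'
  filter_upwards [he'] with x hx
  exact (hS.mem_iff_infDist_zero hne).2 hx

end SpectralMeasure

/-! ### Polynomials defined by a three-term recursion -/

/-- The polynomials with recursion coefficients `a`, `b` and `p₀ = 1`. -/
noncomputable def jacobiPoly (a b : ℕ → ℝ) : ℕ → ℝ[X]
  | 0 => 1
  | 1 => C (a 1)⁻¹ * (X - C (b 1))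
  | n + 2 => C (a (n + 2))⁻¹ *
      ((X - C (b (n + 2))) * jacobiPoly a b (n + 1) - C (a (n + 1)) * jacobiPoly a b n)

theorem jacobiPoly_hasRecursion {a b : ℕ → ℝ} (ha : ∀ n, 0 < a n) :
    HasRecursion a b (jacobiPoly a b) := by
  have h (n : ℕ) (q : ℝ[X]) : C (a n) * (C (a n)⁻¹ * q) = q := by
    rw [← mul_assoc, ← C_mul, mul_inv_cancel₀ (ha n).ne', C_1, one_mul]
  constructor
  · rw [jacobiPoly, jacobiPoly, h]; ring
  · intro n
    rw [jacobiPoly, h]; ring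

theorem natDegree_jacobiPoly {a b : ℕ → ℝ} (ha : ∀ n, 0 < a n) (n : ℕ) :
    (jacobiPoly a b n).natDegree = n ∧ 0 < (jacobiPoly a b n).leadingCoeff := by
  induction n using Nat.twoStepInduction with
  | zero => simp [jacobiPoly]
  | one =>
    rw [jacobiPoly, natDegree_C_mul (inv_ne_zero (ha 1).ne'), leadingCoeff_mul]
    simp [ha 1]
  | more n ih0 ih1 =>
    have hne : jacobiPoly a b (n + 1) ≠ 0 := fun h => by simp [h] at ih1
    have hdeg : ((X - C (b (n + 2))) * jacobiPoly a b (n + 1)).natDegree = n + 2 := by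
      rw [natDegree_mul (X_sub_C_ne_zero _) hne, natDegree_X_sub_C, ih1.1]; ring
    have hlt : (C (a (n + 1)) * jacobiPoly a b n).degree <
        ((X - C (b (n + 2))) * jacobiPoly a b (n + 1)).degree := by
      refine degree_lt_degree ?_
      rw [hdeg, natDegree_C_mul (ha _).ne', ih0.1]
      omega
    rw [jacobiPoly, natDegree_C_mul (inv_ne_zero (ha _).ne'), leadingCoeff_mul,
      leadingCoeff_C, natDegree_eq_of_degree_eq (degree_sub_eq_left_of_degree_lt hlt), hdeg,
      leadingCoeff_sub_of_degree_lt hlt, leadingCoeff_mul, leadingCoeff_X_sub_C, one_mul]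
    exact ⟨rfl, mul_pos (inv_pos.2 (ha _)) ih1.2⟩

theorem aSeq_pos (n : ℕ) : 0 < aSeq n := by
  rw [aSeq]; split_ifs <;> norm_num

theorem jacobi_apply_single_zero {a b : ℕ → ℝ} {L : EllTwo →L[ℂ] EllTwo}
    (hL : IsJacobiOperator a b L) :
    L (lp.single 2 0 1) =
      (b 1 : ℂ) • lp.single 2 0 (1 : ℂ) + (a 1 : ℂ) • lp.single 2 1 (1 : ℂ) := by
  ext k
  rcases k with _ | k
  · rw [(hL _).1]
    simp only [lp.coeFn_add, lp.coeFn_smul, Pi.add_apply, Pi.smul_apply, smul_eq_mul]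
    simp [lp.single_apply]
  · rw [(hL _).2 k]
    simp only [lp.coeFn_add, lp.coeFn_smul, Pi.add_apply, Pi.smul_apply, smul_eq_mul]
    rcases k with _ | k <;> simp [lp.single_apply]

theorem jacobi_apply_single_succ {a b : ℕ → ℝ} {L : EllTwo →L[ℂ] EllTwo}
    (hL : IsJacobiOperator a b L) (n : ℕ) :
    L (lp.single 2 (n + 1) 1) =
      (a (n + 2) : ℂ) • lp.single 2 (n + 2) (1 : ℂ) +
      (b (n + 2) : ℂ) • lp.single 2 (n + 1) (1 : ℂ) + (a (n + 1) : ℂ) • lp.single 2 n (1 : ℂ) := by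
  ext k
  rcases k with _ | k
  · rw [(hL _).1]
    simp only [lp.coeFn_add, lp.coeFn_smul, Pi.add_apply, Pi.smul_apply, smul_eq_mul]
    rcases n with _ | n <;> simp [lp.single_apply]
  · rw [(hL _).2 k]
    simp only [lp.single_apply, Pi.single_apply, lp.coeFn_add, lp.coeFn_smul, Pi.add_apply,
      Pi.smul_apply, smul_eq_mul, mul_ite, mul_one, mul_zero]
    rcases lt_trichotomy k n with h | rfl | h
    · rcases eq_or_ne n (k + 1) with rfl | h' <;> simp <;> grind
    · simp
    · rcases eq_or_ne k (n + 1) with rfl | h' <;> simp <;> grind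

/-- The basis vectors obey the same three-term recursion as the polynomials, and nonzero `a n` lets
one solve for the next term. Orthonormality of the polynomials is thereby that of the basis. -/
theorem aeval_jacobiPoly_apply {H : Type*} [NormedAddCommGroup H] [InnerProductSpace ℂ H]
    {a b : ℕ → ℝ} (ha : ∀ n, 0 < a n) {T : H →L[ℂ] H} {e : ℕ → H}
    (h₀ : T (e 0) = (b 1 : ℂ) • e 0 + (a 1 : ℂ) • e 1)
    (hsucc : ∀ n, T (e (n + 1)) =
      (a (n + 2) : ℂ) • e (n + 2) + (b (n + 2) : ℂ) • e (n + 1) + (a (n + 1) : ℂ) • e n) (n : ℕ) :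
    aeval T (jacobiPoly a b n) (e 0) = e n := by
  obtain ⟨h0, hs⟩ := jacobiPoly_hasRecursion (b := b) ha
  have hC (c : ℝ) (q : ℝ[X]) : aeval T (C c * q) (e 0) = (c : ℂ) • aeval T q (e 0) := by
    rw [map_mul, aeval_C, Algebra.algebraMap_eq_smul_one, smul_one_mul]
    rfl
  have hX (q : ℝ[X]) : aeval T (X * q) (e 0) = T (aeval T q (e 0)) := by
    rw [map_mul, aeval_X]; rfl
  have hz : aeval T (jacobiPoly a b 0) (e 0) = e 0 := by
    simp [jacobiPoly]
  have hac (n : ℕ) : (a n : ℂ) ≠ 0 := by exact_mod_cast (ha n).ne'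
  induction n using Nat.twoStepInduction with
  | zero => exact hz
  | one =>
    have h := congrArg (fun q => aeval T q (e 0)) h0
    simp only [map_add, add_apply, hC, hX] at h
    rw [hz, h₀, add_comm] at h
    exact (smul_right_injective _ (hac 1) (add_right_cancel h)).symm
  | more n ih0 ih1 =>
    have h := congrArg (fun q => aeval T q (e 0)) (hs n)
    simp only [map_add, add_apply, hC, hX] at h
    rw [ih0, ih1, hsucc] at h
    exact (smul_right_injective _ (hac (n + 2)) (add_right_cancel (add_right_cancel h))).symm

theorem isOrthonormalPolynomials_jacobiPoly {a b : ℕ → ℝ} (ha : ∀ n, 0 < a n)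
    {L : EllTwo →L[ℂ] EllTwo} (hL : IsJacobiOperator a b L) {μ : Measure ℝ}
    (hμ : IsSpectralMeasure L firstVec μ) : IsOrthonormalPolynomials μ (jacobiPoly a b) := by
  refine ⟨natDegree_jacobiPoly ha, fun n m => ⟨?_, ?_⟩⟩
  · simpa using hμ.integrable_eval (jacobiPoly a b n * jacobiPoly a b m)
  · have h := hμ.integral_eval_mul_eval (jacobiPoly a b n) (jacobiPoly a b m)
    have he (k : ℕ) := aeval_jacobiPoly_apply ha (e := fun k => lp.single 2 k (1 : ℂ))
      (jacobi_apply_single_zero hL) (jacobi_apply_single_succ hL) k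
    rw [firstVec, he, he, lp.inner_single_left, lp.single_apply,
      Pi.single_apply] at h
    rw [← Complex.ofReal_inj, h]
    split_ifs <;> simp

/-! ### Uniqueness of orthonormal polynomials -/

/-- Integration of polynomials against a measure with finite moments. -/
noncomputable def polyIntegral (μ : Measure ℝ) (hμ : ∀ q : ℝ[X], Integrable (fun x => q.eval x) μ) :
    ℝ[X] →ₗ[ℝ] ℝ where
  toFun q := ∫ x, q.eval x ∂μ
  map_add' q r := by simp only [eval_add]; exact integral_add (hμ q) (hμ r)
  map_smul' c q := by
    simp only [eval_smul, smul_eq_mul, RingHom.id_apply]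
    exact integral_const_mul _ _

theorem exists_sum_of_natDegree_lt {p : ℕ → ℝ[X]}
    (hp : ∀ n, (p n).natDegree = n ∧ 0 < (p n).leadingCoeff) (n : ℕ) (q : ℝ[X])
    (hq : q.degree < n) : ∃ c : ℕ → ℝ, q = ∑ k ∈ Finset.range n, C (c k) * p k := by
  induction n generalizing q with
  | zero => exact ⟨0, by simpa using hq⟩
  | succ n ih =>
    have hlc : (p n).coeff n ≠ 0 := by
      have := (hp n).2.ne'
      rwa [leadingCoeff, (hp n).1] at this
    set d := q.coeff n / (p n).coeff n with hd
    obtain ⟨c, hc⟩ := ih (q - C d * p n) (by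
      rw [degree_lt_iff_coeff_zero]
      intro m hm
      rcases hm.eq_or_lt with rfl | hm
      · rw [coeff_sub, coeff_C_mul, hd, div_mul_cancel₀ _ hlc, sub_self]
      · rw [coeff_sub, coeff_C_mul, coeff_eq_zero_of_degree_lt (hq.trans_le (by exact_mod_cast hm)),
          coeff_eq_zero_of_natDegree_lt (by rw [(hp n).1]; exact hm), mul_zero, sub_zero])
    refine ⟨Function.update c n d, ?_⟩
    rw [Finset.sum_range_succ, Function.update_self, ← sub_eq_iff_eq_add, hc]
    refine Finset.sum_congr rfl fun k hk => ?_
    rw [Function.update_of_ne (Finset.mem_range.1 hk).ne]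

/-- After matching leading coefficients, `p n - t q n` is a combination of the `q k = p k` with `k <
n`, to all of which it is orthogonal. Normalization gives `t ^ 2 = 1`, and positivity gives `t = 1`.
-/
theorem IsOrthonormalPolynomials.unique {μ : Measure ℝ}
    (hμ : ∀ q : ℝ[X], Integrable (fun x => q.eval x) μ) {p q : ℕ → ℝ[X]}
    (hp : IsOrthonormalPolynomials μ p) (hq : IsOrthonormalPolynomials μ q) : p = q := by
  set I := polyIntegral μ hμ with hI
  have hIp (n m : ℕ) : I (p n * p m) = if n = m then 1 else 0 := by
    rw [← (hp.2 n m).2]; simp [hI, polyIntegral]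
  have hIq (n m : ℕ) : I (q n * q m) = if n = m then 1 else 0 := by
    rw [← (hq.2 n m).2]; simp [hI, polyIntegral]
  have hIC (c : ℝ) (r s : ℝ[X]) : I (C c * r * s) = c * I (r * s) := by
    rw [mul_assoc, ← smul_eq_C_mul, map_smul, smul_eq_mul]
  funext n
  induction n using Nat.strong_induction_on with
  | _ n ih =>
    have hlc : 0 < (q n).leadingCoeff := (hq.1 n).2
    set t := (p n).leadingCoeff / (q n).leadingCoeff with ht
    have ht0 : 0 < t := div_pos (hp.1 n).2 hlc
    obtain ⟨c, hc⟩ := exists_sum_of_natDegree_lt hq.1 n (p n - C t * q n) (by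
      rw [degree_lt_iff_coeff_zero]
      intro m hm
      rcases hm.eq_or_lt with rfl | hm
      · have h1 : (p n).coeff n = (p n).leadingCoeff := by rw [leadingCoeff, (hp.1 n).1]
        have h2 : (q n).coeff n = (q n).leadingCoeff := by rw [leadingCoeff, (hq.1 n).1]
        rw [coeff_sub, coeff_C_mul, h1, h2, ht, div_mul_cancel₀ _ hlc.ne', sub_self]
      · rw [coeff_sub, coeff_C_mul, coeff_eq_zero_of_natDegree_lt (by rw [(hp.1 n).1]; exact hm),
          coeff_eq_zero_of_natDegree_lt (by rw [(hq.1 n).1]; exact hm), mul_zero, sub_zero])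
    have hcz : ∀ k ∈ Finset.range n, c k = 0 := by
      intro k hk
      have hkn := Finset.mem_range.1 hk
      have h := congrArg (fun r => I (r * q k)) hc
      simp only [sub_mul, Finset.sum_mul, map_sub, map_sum, hIC, hIq] at h
      rw [← ih k hkn, hIp] at h
      simpa [hkn.ne', hkn] using h.symm
    have hpq : p n = C t * q n := by
      rw [← sub_eq_zero, hc]
      exact Finset.sum_eq_zero fun k hk => by simp [hcz k hk]
    have h1 := hIp n n
    rw [hpq, hIC, mul_comm (q n), hIC, hIq] at h1
    simp only [if_true, mul_one] at h1
    have : t = 1 := by nlinarith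
    rw [hpq, this, C_1, one_mul]

/-! ### Density of the diagonal sequence -/

theorem dyadicIndex_fst_le (n : ℕ) : (dyadicIndex n).1 ≤ n := by
  induction n with
  | zero => simp [dyadicIndex]
  | succ n ih => rw [dyadicIndex]; split_ifs <;> dsimp only <;> omega

theorem exists_dyadicIndex_eq_of_start {m n : ℕ} (hn : dyadicIndex n = (m, 1 - 2 ^ m)) (i : ℕ)
    (hi : 1 - 2 ^ m + (i : ℤ) < 2 ^ m) : ∃ n, dyadicIndex n = (m, 1 - 2 ^ m + (i : ℤ)) := by
  induction i with
  | zero => exact ⟨n, by simpa using hn⟩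
  | succ i ih =>
    push_cast at hi
    obtain ⟨k, hk⟩ := ih (by omega)
    refine ⟨k + 1, ?_⟩
    rw [dyadicIndex, hk]
    simp only
    rw [if_pos (by omega)]
    push_cast
    simp [add_assoc]

theorem exists_dyadicIndex_eq_start (m : ℕ) : ∃ n, dyadicIndex n = (m, 1 - 2 ^ m) := by
  induction m with
  | zero => exact ⟨0, by simp [dyadicIndex]⟩
  | succ m ih =>
    obtain ⟨n, hn⟩ := ih
    have hp : (1 : ℤ) ≤ 2 ^ m := one_le_pow₀ (by norm_num)
    -- The offset `2 * 2 ^ m - 2` reaches the last entry `2 ^ m - 1` of row `m`; the next index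
    -- starts a new row.
    obtain ⟨k, hk⟩ := exists_dyadicIndex_eq_of_start hn (2 * 2 ^ m - 2 : ℤ).toNat (by
      rw [Int.toNat_of_nonneg (by omega)]; omega)
    rw [Int.toNat_of_nonneg (by omega)] at hk
    refine ⟨k + 1, ?_⟩
    rw [dyadicIndex, hk]
    simp only
    rw [if_neg (by omega)]

theorem exists_dyadicIndex_eq {m : ℕ} {j : ℤ} (h₁ : -2 ^ m < j) (h₂ : j < 2 ^ m) :
    ∃ n, m ≤ n ∧ dyadicIndex n = (m, j) := by
  obtain ⟨n, hn⟩ := exists_dyadicIndex_eq_start m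
  obtain ⟨k, hk⟩ := exists_dyadicIndex_eq_of_start hn (j - (1 - 2 ^ m)).toNat (by
    rw [Int.toNat_of_nonneg (by omega)]; omega)
  rw [Int.toNat_of_nonneg (by omega), add_sub_cancel] at hk
  exact ⟨k, by simpa [hk] using dyadicIndex_fst_le k, hk⟩

/-- Arbitrarily late indices are needed: only long blocks give good approximate eigenvectors. -/
theorem exists_beta_near {y ε : ℝ} (hy : |y| ≤ 1) (hε : 0 < ε) (N : ℕ) :
    ∃ n, N ≤ n ∧ 1 ≤ n ∧ |beta n - y| < ε := by
  obtain ⟨m₀, hm₀⟩ := exists_nat_gt (2 / ε)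
  obtain ⟨m, hmN, hm⟩ : ∃ m, N ≤ m ∧ m₀ ≤ m := ⟨max N m₀, le_max_left _ _, le_max_right _ _⟩
  have hp : (1 : ℝ) ≤ 2 ^ m := one_le_pow₀ (by norm_num)
  have hpm : 2 / ε < 2 ^ m := by
    have h1 : (m : ℝ) < 2 ^ m := by exact_mod_cast Nat.lt_two_pow_self
    have h2 : (m₀ : ℝ) ≤ m := by exact_mod_cast hm
    linarith
  obtain ⟨hy1, hy2⟩ := abs_le.1 hy
  -- The factor `2 ^ m - 1`, rather than `2 ^ m`, keeps `|j| < 2 ^ m` even for `y = ±1`.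
  set j : ℤ := ⌊y * (2 ^ m - 1)⌋ with hj
  have hj1 : (j : ℝ) ≤ y * (2 ^ m - 1) := Int.floor_le _
  have hj2 : y * (2 ^ m - 1) < j + 1 := Int.lt_floor_add_one _
  have hl : (1 - 2 ^ m : ℤ) ≤ j := by
    rw [hj, Int.le_floor]; push_cast; nlinarith
  have hu : (j : ℝ) < 2 ^ m := by nlinarith
  obtain ⟨n, hmn, hn⟩ := exists_dyadicIndex_eq (m := m) (j := j) (by omega) (by exact_mod_cast hu)
  refine ⟨n + 1, by omega, by omega, ?_⟩
  rw [beta, Nat.add_sub_cancel, hn]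
  have h0 : (0 : ℝ) < 2 ^ m := by positivity
  have he : (j : ℝ) / 2 ^ m - y = (j - y * 2 ^ m) / 2 ^ m := by field_simp
  rw [div_lt_iff₀ hε] at hpm
  dsimp only
  rw [he, abs_div, abs_of_pos h0, div_lt_iff₀ h0, abs_lt]
  constructor <;> nlinarith

/-! ### Zeros as eigenvalues of truncated Jacobi matrices -/

/-- If every eigenvalue were farther than `r` from `β`, expansion in an eigenbasis would give `‖T u
- β u‖ > r ‖u‖`. -/
theorem exists_eigenvector_near {E : Type*} [NormedAddCommGroup E] [InnerProductSpace ℝ E]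
    [FiniteDimensional ℝ E] {T : E →ₗ[ℝ] E} (hT : T.IsSymmetric) {β r : ℝ} {u : E} (hu : u ≠ 0)
    (h : ‖T u - β • u‖ ≤ r * ‖u‖) : ∃ (x : ℝ) (v : E), v ≠ 0 ∧ T v = x • v ∧ |x - β| ≤ r := by
  by_contra! hcon
  set e := hT.eigenvectorBasis rfl
  set l := hT.eigenvalues rfl
  have hTe (i) : T (e i) = l i • e i := hT.apply_eigenvectorBasis rfl i
  have hfar (i) : r < |l i - β| := hcon _ _ (e.orthonormal.ne_zero i) (hTe i)
  have hr : 0 ≤ r := by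
    by_contra! hr
    have := norm_pos_iff.2 hu
    nlinarith [norm_nonneg (T u - β • u)]
  have hin (i) : inner ℝ (e i) (T u - β • u) = (l i - β) * inner ℝ (e i) u := by
    rw [inner_sub_right, ← hT (e i) u, hTe, real_inner_smul_left, real_inner_smul_right]
    ring
  have h1 : ‖T u - β • u‖ ^ 2 = ∑ i, (l i - β) ^ 2 * inner ℝ (e i) u ^ 2 := by
    rw [← e.sum_sq_norm_inner_right]
    exact Finset.sum_congr rfl fun i _ => by rw [hin, Real.norm_eq_abs, sq_abs, mul_pow]
  have h2 : ‖u‖ ^ 2 = ∑ i, inner ℝ (e i) u ^ 2 := by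
    rw [← e.sum_sq_norm_inner_right]
    exact Finset.sum_congr rfl fun i _ => by rw [Real.norm_eq_abs, sq_abs]
  have hlt (i) : r ^ 2 < (l i - β) ^ 2 := by
    rw [← sq_abs (l i - β)]
    exact pow_lt_pow_left₀ (hfar i) hr (by norm_num)
  have hex : ∃ i, inner ℝ (e i) u ≠ 0 := by
    by_contra! hz
    refine hu (norm_eq_zero.1 (pow_eq_zero_iff two_ne_zero |>.1 ?_))
    rw [h2]
    exact Finset.sum_eq_zero fun i _ => by rw [hz i]; norm_num
  obtain ⟨i₀, hi₀⟩ := hex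
  have h3 : r ^ 2 * ‖u‖ ^ 2 < ‖T u - β • u‖ ^ 2 := by
    rw [h1, h2, Finset.mul_sum]
    refine Finset.sum_lt_sum (fun i _ => ?_) ⟨i₀, Finset.mem_univ _, ?_⟩
    · exact mul_le_mul_of_nonneg_right (hlt i).le (sq_nonneg _)
    · exact mul_lt_mul_of_pos_right (hlt i₀) (by positivity)
  have h4 : ‖T u - β • u‖ ^ 2 ≤ (r * ‖u‖) ^ 2 := pow_le_pow_left₀ (norm_nonneg _) h 2
  rw [mul_pow] at h4
  linarith

/-- The action of a Jacobi matrix on sequences; coordinate `k` is the coordinate number `k + 1`. -/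
def jacobiAction (a b : ℕ → ℝ) (v : ℕ → ℝ) : ℕ → ℝ
  | 0 => b 1 * v 0 + a 1 * v 1
  | k + 1 => a (k + 1) * v k + b (k + 2) * v (k + 1) + a (k + 2) * v (k + 2)

/-- Extension of a finite vector by zero. -/
def extendZero {N : ℕ} (v : EuclideanSpace ℝ (Fin N)) (k : ℕ) : ℝ :=
  if h : k < N then v ⟨k, h⟩ else 0

theorem extendZero_coe {N : ℕ} (v : EuclideanSpace ℝ (Fin N)) (i : Fin N) :
    extendZero v i = v i := by simp [extendZero]

theorem extendZero_of_le {N : ℕ} (v : EuclideanSpace ℝ (Fin N)) {k : ℕ} (h : N ≤ k) :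
    extendZero v k = 0 := by simp [extendZero, h]

/-- The upper left corner of a Jacobi matrix. -/
def jacobiMatrix (a b : ℕ → ℝ) (N : ℕ) : Matrix (Fin N) (Fin N) ℝ := fun i j =>
  (if (j : ℕ) = i then b (i + 1) else 0) + (if (j : ℕ) = i + 1 then a (i + 1) else 0) +
    (if (i : ℕ) = j + 1 then a (j + 1) else 0)

theorem isHermitian_jacobiMatrix (a b : ℕ → ℝ) (N : ℕ) : (jacobiMatrix a b N).IsHermitian := by
  ext i j
  simp only [Matrix.conjTranspose_apply, jacobiMatrix, star_trivial]
  rw [add_right_comm]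
  congr 2
  by_cases h : (i : ℕ) = j
  · simp [h]
  · simp [h, Ne.symm h]

theorem toEuclideanLin_jacobiMatrix_apply (a b : ℕ → ℝ) (N : ℕ) (v : EuclideanSpace ℝ (Fin N))
    (i : Fin N) :
    (Matrix.toEuclideanLin (jacobiMatrix a b N) v) i = jacobiAction a b (extendZero v) i := by
  have h : (Matrix.toEuclideanLin (jacobiMatrix a b N) v) i =
      ∑ j ∈ Finset.range N, ((if j = (i : ℕ) then b (i + 1) else 0) +
        (if j = (i : ℕ) + 1 then a (i + 1) else 0) +
        (if (i : ℕ) = j + 1 then a (j + 1) else 0)) * extendZero v j := by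
    rw [Finset.sum_range]
    simp [Matrix.toLpLin_apply, Matrix.mulVec, dotProduct, jacobiMatrix, extendZero_coe]
  rw [h]
  simp only [add_mul, Finset.sum_add_distrib, ite_mul, zero_mul, Finset.sum_ite_eq',
    Finset.mem_range]
  have hb : (if (i : ℕ) + 1 < N then a (i + 1) * extendZero v (i + 1) else 0) =
      a (i + 1) * extendZero v (i + 1) := by
    split_ifs with hi
    · rfl
    · rw [extendZero_of_le v (by omega), mul_zero]
  rw [hb, if_pos i.2]
  rcases hk : (i : ℕ) with _ | k
  · simp [jacobiAction]
  · have hkN : k < N := by have := i.2; omega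
    simp only [add_left_inj, Finset.sum_ite_eq, Finset.mem_range, hkN, if_true, jacobiAction]
    ring

/-- The first `N` equations determine the solution from `v 0`, up to and including index `N`. -/
theorem eq_mul_eval_of_jacobiAction_eq {a b : ℕ → ℝ} (ha : ∀ n, 0 < a n) {p : ℕ → ℝ[X]}
    (hp : HasRecursion a b p) (hp0 : p 0 = 1) {N : ℕ} {x : ℝ} {v : ℕ → ℝ}
    (hv : ∀ k < N, jacobiAction a b v k = x * v k) (k : ℕ) (hk : k ≤ N) :
    v k = v 0 * (p k).eval x := by
  induction k using Nat.twoStepInduction with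
  | zero => simp [hp0]
  | one =>
    have h1 := hv 0 (by omega)
    have h2 := congrArg (eval x) hp.1
    simp only [eval_mul, eval_add, eval_X, eval_C, hp0, mul_one] at h2
    simp only [jacobiAction] at h1
    refine mul_left_cancel₀ (ha 1).ne' ?_
    linear_combination h1 + v 0 * h2
  | more k ih0 ih1 =>
    have h1 := hv (k + 1) (by omega)
    have h2 := congrArg (eval x) (hp.2 k)
    simp only [eval_mul, eval_add, eval_X, eval_C] at h2
    simp only [jacobiAction] at h1
    have e0 := ih0 (by omega)
    have e1 := ih1 (by omega)
    refine mul_left_cancel₀ (ha (k + 2)).ne' ?_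
    linear_combination h1 + v 0 * h2 + (x - b (k + 2)) * e1 - a (k + 1) * e0

/-- An eigenvector of the corner, extended by zero, satisfies the first `N` equations and vanishes
at index `N`, so `v 0 * p_N(x) = 0`. Were `v 0` zero, the whole eigenvector would vanish. -/
theorem exists_zero_near {a b : ℕ → ℝ} (ha : ∀ n, 0 < a n) {p : ℕ → ℝ[X]}
    (hp : HasRecursion a b p) (hp0 : p 0 = 1) {N : ℕ} {β r : ℝ} {u : EuclideanSpace ℝ (Fin N)}
    (hu : u ≠ 0) (h : ‖Matrix.toEuclideanLin (jacobiMatrix a b N) u - β • u‖ ≤ r * ‖u‖) :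
    ∃ x : ℝ, |x - β| ≤ r ∧ (p N).eval x = 0 := by
  obtain ⟨x, v, hv, hTv, hx⟩ := exists_eigenvector_near
    (Matrix.isSymmetric_toEuclideanLin_iff.2 (isHermitian_jacobiMatrix a b N)) hu h
  refine ⟨x, hx, ?_⟩
  have hact : ∀ k < N, jacobiAction a b (extendZero v) k = x * extendZero v k := by
    intro k hk
    have h1 := toEuclideanLin_jacobiMatrix_apply a b N v ⟨k, hk⟩
    rw [hTv] at h1
    simpa [extendZero, hk] using h1.symm
  have key := eq_mul_eval_of_jacobiAction_eq ha hp hp0 hact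
  have h0 : extendZero v 0 ≠ 0 := by
    intro h0
    refine hv ?_
    ext i
    rw [← extendZero_coe, key i i.2.le, h0, zero_mul]
    rfl
  have hN := key N le_rfl
  rw [extendZero_of_le v le_rfl] at hN
  exact (mul_eq_zero.1 hN.symm).resolve_left h0

/-- The edge state at the right end of the block of length `4 n + 2` starting at index `2 n ^ 2`. -/
noncomputable def edgeState (n : ℕ) : EuclideanSpace ℝ (Fin (2 * n ^ 2 + 4 * n + 1)) :=
  WithLp.toLp 2 fun i => if 2 * n ^ 2 ≤ (i : ℕ) ∧ Even (i : ℕ) then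
    (-3⁻¹ : ℝ) ^ ((2 * n ^ 2 + 4 * n - i) / 2) else 0

theorem extendZero_edgeState (n k : ℕ) : extendZero (edgeState n) k =
    if 2 * n ^ 2 ≤ k ∧ k ≤ 2 * n ^ 2 + 4 * n ∧ Even k then
      (-3⁻¹ : ℝ) ^ ((2 * n ^ 2 + 4 * n - k) / 2) else 0 := by
  rw [extendZero]
  split_ifs with h1 h2 h2
  · simp only [edgeState]; rw [if_pos ⟨h2.1, h2.2.2⟩]
  · simp only [edgeState]; rw [if_neg fun h => h2 ⟨h.1, by omega, h.2⟩]
  · omega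
  · rfl

/-- Rows of even index see only the diagonal, since the state vanishes on odd sites. Inside its
range the odd rows read `3 v_{2j} + v_{2j+2} = 0`, which forces the ratio `-1/3`. Only the weak bond
at the left end is left unbalanced, with value `(-1/3) ^ (2 n)`. -/
theorem jacobiAction_edgeState {n : ℕ} (hn : 1 ≤ n) (k : ℕ) (hk : k < 2 * n ^ 2 + 4 * n + 1) :
    jacobiAction aSeq bSeq (extendZero (edgeState n)) k - beta n * extendZero (edgeState n) k =
      if k + 1 = 2 * n ^ 2 then ((3 : ℝ) ^ (2 * n))⁻¹ else 0 := by
  have hsq : 2 * (n + 1) ^ 2 = 2 * n ^ 2 + 4 * n + 2 := by ring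
  have hb (k : ℕ) (h : 2 * n ^ 2 ≤ k) (h' : k < 2 * n ^ 2 + 4 * n + 2) : bSeq k = beta n :=
    bSeq_block hn h (by omega)
  have hn2 : 1 ≤ n ^ 2 := Nat.one_le_pow _ _ hn
  have hE := extendZero_edgeState n
  generalize extendZero (edgeState n) = v at *
  generalize n ^ 2 = s at *
  rcases Nat.even_or_odd' k with ⟨j, rfl | rfl⟩
  · have hvo (i : ℕ) (hi : Odd i) : v i = 0 := by
      rw [hE, if_neg fun h => Nat.not_even_iff_odd.2 hi h.2.2]
    have hv : bSeq (2 * j + 1) * v (2 * j) = beta n * v (2 * j) := by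
      by_cases h : 2 * s ≤ 2 * j
      · rw [hb _ (by omega) (by omega)]
      · rw [hE, if_neg fun h' => h h'.1]; simp
    rw [if_neg (by omega)]
    rcases j with _ | j
    · have := hvo 1 odd_one
      simp only [jacobiAction, mul_zero, zero_add] at hv ⊢
      rw [this, hv]; ring
    · rw [show 2 * (j + 1) = 2 * j + 1 + 1 by ring] at *
      simp only [jacobiAction]
      rw [hvo (2 * j + 1) ⟨j, rfl⟩, hvo (2 * j + 1 + 2) ⟨j + 1, by ring⟩, hv]; ring
  · have hvo : v (2 * j + 1) = 0 := by
      rw [hE, if_neg fun h => Nat.not_even_iff_odd.2 ⟨j, rfl⟩ h.2.2]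
    have h1 : aSeq (2 * j + 1) = 3 := by rw [aSeq, if_pos ⟨j, rfl⟩]
    have h2 : aSeq (2 * j + 2) = 1 := by
      rw [aSeq, if_neg (Nat.not_odd_iff_even.2 ⟨j + 1, by ring⟩)]
    have he : Even (2 * j) := ⟨j, by ring⟩
    have he2 : Even (2 * j + 2) := ⟨j + 1, by ring⟩
    simp only [jacobiAction]
    rw [hvo, h1, h2, hE, hE]
    simp only [he, he2, and_true]
    rcases lt_trichotomy (j + 1) s with h | h | h
    · rw [if_neg (by omega), if_neg (by omega), if_neg (by omega)]; ring
    · rw [if_neg (by omega), if_pos (by omega), if_pos (by omega)]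
      rw [show (2 * s + 4 * n - (2 * j + 2)) / 2 = 2 * n by omega, pow_mul, pow_mul]
      norm_num
      rw [one_div, inv_pow]
    · rw [if_pos (by omega), if_pos (by omega), if_neg (by omega)]
      rw [show (2 * s + 4 * n - 2 * j) / 2 = (2 * s + 4 * n - (2 * j + 2)) / 2 + 1 by omega,
        pow_succ]
      ring

theorem one_le_norm_edgeState (n : ℕ) : 1 ≤ ‖edgeState n‖ := by
  have h := PiLp.norm_apply_le (edgeState n) ⟨2 * n ^ 2 + 4 * n, by omega⟩
  have he : Even (2 * n ^ 2 + 4 * n) := ⟨n ^ 2 + 2 * n, by ring⟩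
  simpa [edgeState, he] using h

theorem exists_zero_near_beta {p : ℕ → ℝ[X]} (hp : HasRecursion aSeq bSeq p) (hp0 : p 0 = 1)
    {n : ℕ} (hn : 1 ≤ n) :
    ∃ x : ℝ, |x - beta n| ≤ ((3 : ℝ) ^ (2 * n))⁻¹ ∧ (p (2 * (n + 1) ^ 2 - 1)).eval x = 0 := by
  have hsq : 2 * (n + 1) ^ 2 - 1 = 2 * n ^ 2 + 4 * n + 1 := by
    have : 2 * (n + 1) ^ 2 = 2 * n ^ 2 + 4 * n + 1 + 1 := by ring
    omega
  have hn2 : 1 ≤ n ^ 2 := Nat.one_le_pow _ _ hn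
  have h1 := one_le_norm_edgeState n
  have hr : (0 : ℝ) < ((3 : ℝ) ^ (2 * n))⁻¹ := by positivity
  rw [hsq]
  refine exists_zero_near aSeq_pos hp hp0 (u := edgeState n) (norm_pos_iff.1 (by linarith)) ?_
  have hres : Matrix.toEuclideanLin (jacobiMatrix aSeq bSeq (2 * n ^ 2 + 4 * n + 1)) (edgeState n)
      - beta n • edgeState n =
      EuclideanSpace.single ⟨2 * n ^ 2 - 1, by omega⟩ ((3 : ℝ) ^ (2 * n))⁻¹ := by
    ext i
    have h := jacobiAction_edgeState hn i i.2
    rw [← toEuclideanLin_jacobiMatrix_apply, extendZero_coe] at h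
    rw [PiLp.sub_apply, PiLp.smul_apply, smul_eq_mul, h, PiLp.single_apply]
    refine if_congr ?_ rfl rfl
    rw [Fin.ext_iff]
    dsimp only
    omega
  rw [hres, PiLp.norm_single, Real.norm_eq_abs, abs_of_pos hr]
  exact le_mul_of_one_le_right hr.le h1

/-! ### Approximate eigenfunctions inside the bands -/

/-- Boundary term of the truncated plane wave with profile `c` at energy `τ`. -/
noncomputable def waveBoundary (p : ℕ → ℝ[X]) (c : ℕ → ℝ) (τ : ℝ) (i : ℕ) : ℝ[X] :=
  C (3 * (τ * c (i + 1))) * p (2 * i) - C (3 * (c i + 3 * c (i + 1))) * p (2 * i + 1)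

/-- One period of the plane wave with profile `c` at energy `τ`. -/
noncomputable def waveCell (p : ℕ → ℝ[X]) (c : ℕ → ℝ) (τ : ℝ) (i : ℕ) : ℝ[X] :=
  C (τ * c (i + 1)) * p (2 * i + 1) + C (c (i + 1) + 3 * c (i + 2)) * p (2 * i + 2)

/-- The coefficients `τ c_{i+1}` and `c_{i+1} + 3 c_{i+2}` solve the first-order system of the
period-two matrix at energy `τ`; eliminating one of them gives `hc`. All interior terms cancel,
leaving a difference of boundary terms. -/
theorem sub_mul_waveCell {p : ℕ → ℝ[X]} (hp : HasRecursion aSeq bSeq p) {c : ℕ → ℝ} {τ β : ℝ}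
    (hc : ∀ i, 3 * c i + 10 * c (i + 1) + 3 * c (i + 2) = τ ^ 2 * c (i + 1)) {i : ℕ}
    (hb₁ : bSeq (2 * i + 2) = β) (hb₂ : bSeq (2 * i + 3) = β) :
    (X - C (β + τ)) * waveCell p c τ i = waveBoundary p c τ i - waveBoundary p c τ (i + 1) := by
  have h1 := hp.2 (2 * i)
  have h2 := hp.2 (2 * i + 1)
  have a1 : aSeq (2 * i + 1) = 3 := by rw [aSeq, if_pos ⟨i, rfl⟩]
  have a2 : aSeq (2 * i + 2) = 1 := by
    rw [aSeq, if_neg (Nat.not_odd_iff_even.2 ⟨i + 1, by ring⟩)]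
  have a3 : aSeq (2 * i + 3) = 3 := by rw [aSeq, if_pos ⟨i + 1, by ring⟩]
  rw [a1, a2, hb₁] at h1
  rw [show 2 * i + 1 + 2 = 2 * i + 3 by ring, show 2 * i + 1 + 1 = 2 * i + 2 by ring, a2, a3,
    hb₂] at h2
  have h3 := congrArg (fun y : ℝ => (C y : ℝ[X])) (hc i)
  simp only [waveCell, waveBoundary, map_add, map_mul, map_pow, map_one, map_ofNat] at *
  rw [show 2 * (i + 1) = 2 * i + 2 by ring, show 2 * i + 2 + 1 = 2 * i + 3 by ring,
    show i + 1 + 1 = i + 2 by ring]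
  linear_combination (C τ * C (c (i + 1))) * h1 + (C (c (i + 1)) + 3 * C (c (i + 2))) * h2 +
    p (2 * i + 1) * h3

/-- The boundary terms telescope, because every diagonal index used, from `2 n ^ 2 + 2` to `2 n ^ 2
+ 4 n + 1`, lies in block `n`. -/
theorem sub_mul_sum_waveCell {p : ℕ → ℝ[X]} (hp : HasRecursion aSeq bSeq p) {c : ℕ → ℝ} {τ : ℝ}
    (hc : ∀ i, 3 * c i + 10 * c (i + 1) + 3 * c (i + 2) = τ ^ 2 * c (i + 1)) {n : ℕ} (hn : 1 ≤ n) :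
    (X - C (beta n + τ)) * ∑ i ∈ Finset.Ico (n ^ 2) (n ^ 2 + 2 * n), waveCell p c τ i =
      waveBoundary p c τ (n ^ 2) - waveBoundary p c τ (n ^ 2 + 2 * n) := by
  have hsq : 2 * (n + 1) ^ 2 = 2 * n ^ 2 + 4 * n + 2 := by ring
  rw [Finset.mul_sum, ← neg_sub (waveBoundary p c τ (n ^ 2 + 2 * n)),
    ← Finset.sum_Ico_sub (waveBoundary p c τ) (by omega), ← Finset.sum_neg_distrib]
  refine Finset.sum_congr rfl fun i hi => ?_
  rw [Finset.mem_Ico] at hi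
  rw [neg_sub]
  exact sub_mul_waveCell hp hc (bSeq_block hn (by omega) (by omega))
    (bSeq_block hn (by omega) (by omega))

theorem map_waveBoundary_sq {p : ℕ → ℝ[X]} {I : ℝ[X] →ₗ[ℝ] ℝ}
    (hI : ∀ n m, I (p n * p m) = if n = m then 1 else 0) (c : ℕ → ℝ) (τ : ℝ) (i : ℕ) :
    I (waveBoundary p c τ i * waveBoundary p c τ i) =
      9 * ((τ * c (i + 1)) ^ 2 + (c i + 3 * c (i + 1)) ^ 2) := by
  simp only [waveBoundary, ← smul_eq_C_mul, sub_mul, mul_sub, smul_mul_smul_comm, map_sub, map_smul,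
    hI, smul_eq_mul]
  simp
  ring

theorem map_sum_waveCell_sq {p : ℕ → ℝ[X]} {I : ℝ[X] →ₗ[ℝ] ℝ}
    (hI : ∀ n m, I (p n * p m) = if n = m then 1 else 0) (c : ℕ → ℝ) (τ : ℝ) (s : Finset ℕ) :
    I ((∑ i ∈ s, waveCell p c τ i) * ∑ i ∈ s, waveCell p c τ i) =
      ∑ i ∈ s, ((τ * c (i + 1)) ^ 2 + (c (i + 1) + 3 * c (i + 2)) ^ 2) := by
  have h (i j : ℕ) : I (waveCell p c τ i * waveCell p c τ j) =
      if i = j then (τ * c (i + 1)) ^ 2 + (c (i + 1) + 3 * c (i + 2)) ^ 2 else 0 := by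
    simp only [waveCell, ← smul_eq_C_mul, add_mul, mul_add, smul_mul_smul_comm, map_add, map_smul,
      hI, smul_eq_mul]
    rw [if_neg (show ¬ 2 * i + 2 = 2 * j + 1 by omega),
      if_neg (show ¬ 2 * i + 1 = 2 * j + 2 by omega)]
    by_cases hij : i = j
    · subst hij; simp; ring
    · simp [hij]
  rw [Finset.sum_mul_sum, map_sum]
  refine Finset.sum_congr rfl fun i hi => ?_
  rw [map_sum]
  simp only [h]
  rw [Finset.sum_ite_eq, if_pos hi]

/-- If `μ` gives no mass to a neighbourhood of `beta n + τ`, the plane waves of energy `τ` in the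
block number `n` cannot be approximate eigenfunctions. -/
theorem wave_bound {μ : Measure ℝ} (hμ : ∀ q : ℝ[X], Integrable (fun x => q.eval x) μ)
    {p : ℕ → ℝ[X]} (hp : IsOrthonormalPolynomials μ p) (hr : HasRecursion aSeq bSeq p) {c : ℕ → ℝ}
    {τ δ : ℝ} (hc : ∀ i, 3 * c i + 10 * c (i + 1) + 3 * c (i + 2) = τ ^ 2 * c (i + 1))
    (hc1 : ∀ i, |c i| ≤ 1) (hτ : |τ| ≤ 4) {n : ℕ} (hn : 1 ≤ n) (hδ : 0 ≤ δ)
    (hnull : ∀ᵐ x ∂μ, δ ≤ |x - (beta n + τ)|) :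
    δ ^ 2 * ∑ i ∈ Finset.Ico (n ^ 2) (n ^ 2 + 2 * n), (τ * c (i + 1)) ^ 2 ≤ 1152 := by
  set I := polyIntegral μ hμ with hIdef
  have hIe (q : ℝ[X]) : I q = ∫ x, q.eval x ∂μ := rfl
  have hI (n m : ℕ) : I (p n * p m) = if n = m then 1 else 0 := by
    rw [← (hp.2 n m).2, hIe]; simp
  set q := ∑ i ∈ Finset.Ico (n ^ 2) (n ^ 2 + 2 * n), waveCell p c τ i with hq
  set G := waveBoundary p c τ (n ^ 2)
  set G' := waveBoundary p c τ (n ^ 2 + 2 * n)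
  have hmain : (X - C (beta n + τ)) * q = G - G' := sub_mul_sum_waveCell hr hc hn
  have h1 : δ ^ 2 * I (q * q) ≤ I ((G - G') * (G - G')) := by
    rw [← hmain, hIe, hIe, ← integral_const_mul]
    refine integral_mono_ae ((hμ _).const_mul _) (hμ _) ?_
    filter_upwards [hnull] with x hx
    simp only [eval_mul, eval_sub, eval_X, eval_C]
    have hsq : δ ^ 2 ≤ (x - (beta n + τ)) ^ 2 := by
      rw [← sq_abs (x - _)]; exact pow_le_pow_left₀ hδ hx 2
    nlinarith [mul_le_mul_of_nonneg_right hsq (mul_self_nonneg (q.eval x))]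
  -- The parallelogram identity, with the nonnegative square of `G + G'` dropped.
  have h2 : I ((G - G') * (G - G')) ≤ 2 * I (G * G) + 2 * I (G' * G') := by
    have h3 : 0 ≤ I ((G + G') * (G + G')) := by
      rw [hIe]
      refine integral_nonneg fun x => ?_
      rw [eval_mul]
      exact mul_self_nonneg _
    have h4 : (G - G') * (G - G') + (G + G') * (G + G') =
        (2 : ℝ) • (G * G) + (2 : ℝ) • (G' * G') := by
      rw [two_smul, two_smul]; ring
    have h5 := congrArg I h4
    simp only [map_add, map_smul, smul_eq_mul] at h5
    linarith
  -- Both squares are at most `4 ^ 2`, and `9 * (16 + 16) = 288`; the final constant is `4 * 288 =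
  -- 1152`.
  have hG (i : ℕ) : I (waveBoundary p c τ i * waveBoundary p c τ i) ≤ 288 := by
    rw [map_waveBoundary_sq hI]
    have e1 : (τ * c (i + 1)) ^ 2 ≤ 16 := by
      rw [← sq_abs, abs_mul]
      have : |τ| * |c (i + 1)| ≤ 4 * 1 := mul_le_mul hτ (hc1 _) (abs_nonneg _) (by norm_num)
      have h0 : 0 ≤ |τ| * |c (i + 1)| := by positivity
      nlinarith
    have e2 : (c i + 3 * c (i + 1)) ^ 2 ≤ 16 := by
      obtain ⟨u1, u2⟩ := abs_le.1 (hc1 i)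
      obtain ⟨v1, v2⟩ := abs_le.1 (hc1 (i + 1))
      nlinarith
    linarith
  have h6 : ∑ i ∈ Finset.Ico (n ^ 2) (n ^ 2 + 2 * n), (τ * c (i + 1)) ^ 2 ≤ I (q * q) := by
    rw [hq, map_sum_waveCell_sq hI]
    exact Finset.sum_le_sum fun i _ => le_add_of_nonneg_right (sq_nonneg _)
  have h7 := mul_le_mul_of_nonneg_left h6 (sq_nonneg δ)
  have := hG (n ^ 2)
  have := hG (n ^ 2 + 2 * n)
  linarith

theorem three_mul_cos_add {θ τ : ℝ} (hθ : τ ^ 2 = 10 + 6 * Real.cos θ) (i : ℕ) :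
    3 * Real.cos (i * θ) + 10 * Real.cos ((i + 1 : ℕ) * θ) + 3 * Real.cos ((i + 2 : ℕ) * θ) =
      τ ^ 2 * Real.cos ((i + 1 : ℕ) * θ) := by
  have e0 : (i : ℝ) * θ = (i + 1 : ℕ) * θ - θ := by push_cast; ring
  have e2 : ((i + 2 : ℕ) : ℝ) * θ = (i + 1 : ℕ) * θ + θ := by push_cast; ring
  rw [e0, e2, Real.cos_sub, Real.cos_add, hθ]
  ring

theorem three_mul_sin_add {θ τ : ℝ} (hθ : τ ^ 2 = 10 + 6 * Real.cos θ) (i : ℕ) :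
    3 * Real.sin (i * θ) + 10 * Real.sin ((i + 1 : ℕ) * θ) + 3 * Real.sin ((i + 2 : ℕ) * θ) =
      τ ^ 2 * Real.sin ((i + 1 : ℕ) * θ) := by
  have e0 : (i : ℝ) * θ = (i + 1 : ℕ) * θ - θ := by push_cast; ring
  have e2 : ((i + 2 : ℕ) : ℝ) * θ = (i + 1 : ℕ) * θ + θ := by push_cast; ring
  rw [e0, e2, Real.sin_sub, Real.sin_add, hθ]
  ring

theorem add_mem_support {μ : Measure ℝ} (hμ : ∀ q : ℝ[X], Integrable (fun x => q.eval x) μ)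
    {p : ℕ → ℝ[X]} (hp : IsOrthonormalPolynomials μ p) (hr : HasRecursion aSeq bSeq p) {y τ : ℝ}
    (hy : |y| ≤ 1) (hτ₂ : 2 ≤ |τ|) (hτ₄ : |τ| ≤ 4) : y + τ ∈ μ.support := by
  by_contra hcon
  obtain ⟨U, hU, hμU⟩ := Measure.notMem_support_iff_exists.1 hcon
  obtain ⟨ε, hε, hball⟩ := Metric.mem_nhds_iff.1 hU
  have hτ1 : 4 ≤ τ ^ 2 := by rw [← sq_abs]; nlinarith
  have hτ2 : τ ^ 2 ≤ 16 := by rw [← sq_abs]; nlinarith [abs_nonneg τ]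
  have hθ : τ ^ 2 = 10 + 6 * Real.cos (Real.arccos ((τ ^ 2 - 10) / 6)) := by
    rw [Real.cos_arccos (by linarith) (by linarith)]; ring
  set θ := Real.arccos ((τ ^ 2 - 10) / 6)
  -- The cosine and sine bounds add to `2 * 1152 = 2304`, while `τ ^ 2 ≥ 4` makes the sum of their
  -- left sides at least `2 n ε ^ 2`.
  obtain ⟨N, hN⟩ := exists_nat_gt (2304 / (2 * ε ^ 2))
  obtain ⟨n, hNn, hn, hβ⟩ := exists_beta_near hy (half_pos hε) N
  have hnull : ∀ᵐ x ∂μ, ε / 2 ≤ |x - (beta n + τ)| := by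
    refine measure_mono_null (fun x hx => hball ?_) hμU
    rw [Set.mem_compl_iff, Set.mem_ofPred_eq, not_le] at hx
    rw [Metric.mem_ball, Real.dist_eq]
    calc |x - (y + τ)| = |(x - (beta n + τ)) + (beta n - y)| := by ring_nf
      _ ≤ _ := abs_add_le _ _
      _ < ε := by linarith
  have h1 := wave_bound hμ hp hr (c := fun i => Real.cos (i * θ)) (three_mul_cos_add hθ)
    (fun i => Real.abs_cos_le_one _) hτ₄ hn (half_pos hε).le hnull
  have h2 := wave_bound hμ hp hr (c := fun i => Real.sin (i * θ)) (three_mul_sin_add hθ)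
    (fun i => Real.abs_sin_le_one _) hτ₄ hn (half_pos hε).le hnull
  -- Using both waves makes the total norm exact, so no lower bound for either sum alone is needed.
  have h3 : ∑ i ∈ Finset.Ico (n ^ 2) (n ^ 2 + 2 * n), (τ * Real.cos ((i + 1 : ℕ) * θ)) ^ 2 +
      ∑ i ∈ Finset.Ico (n ^ 2) (n ^ 2 + 2 * n), (τ * Real.sin ((i + 1 : ℕ) * θ)) ^ 2 =
      2 * n * τ ^ 2 := by
    rw [← Finset.sum_add_distrib]
    have (i : ℕ) : (τ * Real.cos ((i + 1 : ℕ) * θ)) ^ 2 + (τ * Real.sin ((i + 1 : ℕ) * θ)) ^ 2 =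
        τ ^ 2 := by
      rw [mul_pow, mul_pow, ← mul_add, Real.cos_sq_add_sin_sq, mul_one]
    simp only [this, Finset.sum_const, Nat.card_Ico, Nat.add_sub_cancel_left, nsmul_eq_mul]
    push_cast
    ring
  have hNn' : (N : ℝ) ≤ n := by exact_mod_cast hNn
  have h4 : 2304 < n * (2 * ε ^ 2) := by
    rw [div_lt_iff₀ (by positivity)] at hN
    exact hN.trans_le (mul_le_mul_of_nonneg_right hNn' (by positivity))
  have h5 : (ε / 2) ^ 2 * (2 * n * τ ^ 2) ≤ 2304 := by
    rw [← h3, mul_add]; linarith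
  have h6 : n * (2 * ε ^ 2) ≤ (ε / 2) ^ 2 * (2 * n * τ ^ 2) := by
    have : 0 ≤ (n : ℝ) * ε ^ 2 := by positivity
    nlinarith
  linarith

theorem bands_subset_support {μ : Measure ℝ}
    (hμ : ∀ q : ℝ[X], Integrable (fun x => q.eval x) μ) {p : ℕ → ℝ[X]}
    (hp : IsOrthonormalPolynomials μ p) (hr : HasRecursion aSeq bSeq p) :
    Set.Icc (-5 : ℝ) (-1) ∪ Set.Icc (1 : ℝ) 5 ⊆ μ.support := by
  rintro x (⟨h1, h2⟩ | ⟨h1, h2⟩)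
  · have hneg : (x - 3) / 2 ≤ 0 := by linarith
    -- This affine splitting of `x` carries the band onto `y ∈ [-1, 1]` and `τ ∈ [-4, -2]`
    -- simultaneously.
    have h := add_mem_support hμ hp hr (y := (x + 3) / 2) (τ := (x - 3) / 2)
      (by rw [abs_le]; constructor <;> linarith) (by rw [abs_of_nonpos hneg]; linarith)
      (by rw [abs_of_nonpos hneg]; linarith)
    rwa [show (x + 3) / 2 + (x - 3) / 2 = x by ring] at h
  · have hpos : 0 ≤ (x + 3) / 2 := by linarith
    have h := add_mem_support hμ hp hr (y := (x - 3) / 2) (τ := (x + 3) / 2)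
      (by rw [abs_le]; constructor <;> linarith) (by rw [abs_of_nonneg hpos]; linarith)
      (by rw [abs_of_nonneg hpos]; linarith)
    rwa [show (x - 3) / 2 + (x + 3) / 2 = x by ring] at h

/-! ### Density of the zeros in the gap -/

theorem closure_zeros_eq_Icc {p : ℕ → ℝ[X]} (hp : HasRecursion aSeq bSeq p) (hp0 : p 0 = 1) :
    closure {x : ℝ | x ∈ Set.Ioo (-1 : ℝ) 1 ∧ ∃ n : ℕ, (p n).eval x = 0} = Set.Icc (-1 : ℝ) 1 := by
  refine subset_antisymm ?_ ?_
  · exact closure_minimal (fun x hx => Set.Ioo_subset_Icc_self hx.1) isClosed_Icc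
  · rw [← closure_Ioo (by norm_num : (-1 : ℝ) ≠ 1)]
    refine closure_minimal (fun y hy => ?_) isClosed_closure
    rw [Metric.mem_closure_iff]
    intro ε hε
    -- The zero found below lies within `2 δ` of `y`; the last two bounds keep it inside the open
    -- gap.
    set δ := min (ε / 2) (min ((1 - y) / 2) ((1 + y) / 2)) with hδ
    have hδ0 : 0 < δ := by
      obtain ⟨h1, h2⟩ := hy
      refine lt_min (by linarith) (lt_min (by linarith) (by linarith))
    have d1 : δ ≤ ε / 2 := min_le_left _ _
    have d2 : δ ≤ (1 - y) / 2 := (min_le_right _ _).trans (min_le_left _ _)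
    have d3 : δ ≤ (1 + y) / 2 := (min_le_right _ _).trans (min_le_right _ _)
    obtain ⟨N, hN⟩ := exists_pow_lt_of_lt_one hδ0 (by norm_num : (3⁻¹ : ℝ) < 1)
    obtain ⟨n, hNn, hn, hβ⟩ := exists_beta_near (abs_le.2 ⟨hy.1.le, hy.2.le⟩) hδ0 N
    obtain ⟨x, hx, hz⟩ := exists_zero_near_beta hp hp0 hn
    have hpow : ((3 : ℝ) ^ (2 * n))⁻¹ ≤ (3⁻¹ : ℝ) ^ N := by
      rw [← inv_pow]
      exact pow_le_pow_of_le_one (by norm_num) (by norm_num) (by omega)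
    obtain ⟨x1, x2⟩ := abs_le.1 (hx.trans hpow)
    obtain ⟨b1, b2⟩ := abs_lt.1 hβ
    refine ⟨x, ⟨⟨by linarith, by linarith⟩, _, hz⟩, ?_⟩
    rw [Real.dist_eq, abs_lt]
    constructor <;> linarith

end GapExample

theorem mainTheorem3 :
    ∃ L : GapExample.EllTwo →L[ℂ] GapExample.EllTwo,
      GapExample.IsJacobiOperator GapExample.aSeq GapExample.bSeq L ∧
      (∃ μ : Measure ℝ, GapExample.IsSpectralMeasure L GapExample.firstVec μ) ∧
      ∀ μ : Measure ℝ, GapExample.IsSpectralMeasure L GapExample.firstVec μ →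
        μ.support = Set.Icc (-5 : ℝ) (-1) ∪ Set.Icc (1 : ℝ) 5 ∧
        (∃ p : ℕ → ℝ[X], GapExample.IsOrthonormalPolynomials μ p) ∧
        ∀ p : ℕ → ℝ[X], GapExample.IsOrthonormalPolynomials μ p →
          GapExample.HasRecursion GapExample.aSeq GapExample.bSeq p ∧
          (∀ n : ℕ, 1 ≤ n → ∃ x : ℝ,
            |x - GapExample.beta n| ≤ 2 * ((3 : ℝ) ^ (2 * n))⁻¹ ∧
              (p (2 * (n + 1) ^ 2 - 1)).eval x = 0) ∧
          closure {x : ℝ | x ∈ Set.Ioo (-1 : ℝ) 1 ∧ ∃ n : ℕ, (p n).eval x = 0} =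
            Set.Icc (-1 : ℝ) 1 := by
  open GapExample in
  refine ⟨jacobiOp, jacobiOp_isJacobiOperator,
    exists_isSpectralMeasure isSelfAdjoint_jacobiOp firstVec, fun μ hμ => ?_⟩
  have horth := isOrthonormalPolynomials_jacobiPoly aSeq_pos jacobiOp_isJacobiOperator hμ
  have hrec := jacobiPoly_hasRecursion (b := bSeq) aSeq_pos
  refine ⟨subset_antisymm ?_ ?_, ⟨_, horth⟩, fun p hp => ?_⟩
  · exact hμ.support_subset (isClosed_Icc.union isClosed_Icc) ⟨1, Or.inr ⟨le_rfl, by norm_num⟩⟩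
      spectrum_jacobiOp_subset
  · exact bands_subset_support hμ.integrable_eval horth hrec
  -- Uniqueness reduces an arbitrary orthonormal family to `jacobiPoly`, where the recursion and `p
  -- 0 = 1` are known.
  · obtain rfl := hp.unique hμ.integrable_eval horth
    refine ⟨hrec, fun n hn => ?_, closure_zeros_eq_Icc hrec rfl⟩
    obtain ⟨x, hx, hz⟩ := exists_zero_near_beta hrec rfl hn
    have h0 : (0 : ℝ) ≤ ((3 : ℝ) ^ (2 * n))⁻¹ := by positivity
    exact ⟨x, by linarith, hz⟩
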